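/- Let $\mathbb I=[0,1]$ with Lebesgue measure $\lambda$. A $d$-dimensional copula is the restriction to $\mathbb I^d$ of the distribution function of a probability measure $\mu_C$ on $\mathbb I^d$ with uniform one-dimensional margins, $C(\mathbf u)=\mu_C([\mathbf 0,\mathbf u])$; its Markov kernel $K_C(v,\cdot)$ is the regular conditional distribution (under $\mu_C$) of the first $d-1$ coordinates given that the last coordinate equals $v$ (unique for $\lambda$-a.e. $v$). For $d$-dimensional copulas, $C_n\xrightarrow{\mathrm{wcc}}C$ (weak conditional convergence) means that for $\lambda$-almost every $v\in\mathbb I$ the probability measures $K_{C_n}(v,\cdot)$ converge weakly to $K_C(v,\cdot)$, and $d_\infty(C,D)=\max_{\mathbf u\in\mathbb I^d}|C(\mathbf u)-D(\mathbf u)|$. For a trivariate copula $C$ let $C_{13}(u_1,v)=C(u_1,1,v)$ and $C_{23}(u_2,v)=C(1,u_2,v)$, and let $F_{1|3}(x|t)=K_C(t,[0,x]\times\mathbb I)$ and $F_{2|3}(x|t)=K_C(t,\mathbb I\times[0,x])$. Let $\mathcal C^3_c$ be the class of trivariate copulas for which $F_{1|3}(\cdot|t)$ and $F_{2|3}(\cdot|t)$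 are continuous for $\lambda$-almost every $t\in\mathbb I$. For $C\in\mathcal C^3_c$ and almost every $t$ let $C_{12;3}^t$ be the unique bivariate copula with $$K_C(t,[0,u_1]\times[0,u_2])=C_{12;3}^t\big(F_{1|3}(u_1|t),F_{2|3}(u_2|t)\big)\qquad\text{for all }(u_1,u_2)\in\mathbb I^2 ,$$ and define the partial copula $C_p$ and the partial vine copula $\psi(C)$ by $$C_p(\mathbf s)=\int_{\mathbb I}C_{12;3}^t(\mathbf s)\,d\lambda(t),\qquad \psi(C)(u_1,u_2,v)=\int_{[0,v]}C_p\big(F_{1|3}(u_1|t),F_{2|3}(u_2|t)\big)\,d\lambda(t).$$ **Theorem.** Let $C,C_1,C_2,\ldots\in\mathcal C^3_c$ with $C_n\xrightarrow{\mathrm{wcc}}C$. Then: 1. $(C_n)_{13}\xrightarrow{\mathrm{wcc}}C_{13}$ and $(C_n)_{23}\xrightarrow{\mathrm{wcc}}C_{23}$; 2. $C_p$ and all $(C_n)_p$ are bivariate copulas, and $d_\infty\big((C_n)_p,C_p\big)\to0$; 3. $\psi(C)$ and all $\psi(C_n)$ belong to $\mathcal C^3_c$, and $\psi(C_n)\xrightarrow{\mathrm{wcc}}\psi(C)$.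 -/

import Mathlib

open MeasureTheory ProbabilityTheory Filter Topology
open scoped unitInterval

/-- A `d`-stochastic measure: a probability measure on the unit cube whose one-dimensional margins
are all equal to Lebesgue measure on the unit interval. -/
structure IsStochasticMeasure {d : ℕ} (μ : Measure (Fin d → I)) : Prop where
  isProbabilityMeasure : IsProbabilityMeasure μ
  map_eval : ∀ i, μ.map (fun u => u i) = volume

/-- A `d`-dimensional copula: the distribution function `u ↦ μ [0, u]` on the unit cube of a
`d`-stochastic measure `μ`. -/
def IsCopula {d : ℕ} (C : (Fin d → I) → ℝ) : Prop :=
  ∃ μ : Measure (Fin d → I), IsStochasticMeasure μ ∧ ∀ u, C u = μ.real (Set.Iic u)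

open Classical in
/-- The `d`-stochastic measure `μ_C` of a copula `C`; it is unique, since the boxes `[0, u]` form a
generating π-system. (The value is `0` if `C` is not a copula.) -/
noncomputable def copulaMeasure {d : ℕ} (C : (Fin d → I) → ℝ) : Measure (Fin d → I) :=
  if h : IsCopula C then h.choose else 0

instance copulaMeasure_isFiniteMeasure {d : ℕ} (C : (Fin d → I) → ℝ) :
    IsFiniteMeasure (copulaMeasure C) := by
  unfold copulaMeasure
  split_ifs with h
  · have := h.choose_spec.1.isProbabilityMeasure
    infer_instance
  · infer_instance

/-- The Markov kernel `K_C` of a copula `C`: a regular conditional distribution under `μ_C` of the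
first `d` coordinates given the last one. The equivalence used here splits `u` into the pair
`(last coordinate, first d coordinates)`. Two versions agree for almost every value of the last
coordinate. -/
noncomputable def copulaKernel {d : ℕ} (C : (Fin (d + 1) → I) → ℝ) : Kernel I (Fin d → I) :=
  ((copulaMeasure C).map (MeasurableEquiv.piFinSuccAbove (fun _ => I) (Fin.last d))).condKernel

instance copulaKernel_isMarkovKernel {d : ℕ} (C : (Fin (d + 1) → I) → ℝ) :
    IsMarkovKernel (copulaKernel C) := by
  unfold copulaKernel
  infer_instance

/-- The probability measure `K_C(v, ·)`. -/
noncomputable def copulaCondLaw {d : ℕ} (C : (Fin (d + 1) → I) → ℝ) (v : I) :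
    ProbabilityMeasure (Fin d → I) :=
  ⟨copulaKernel C v, inferInstance⟩

/-- Weak conditional convergence (with respect to the last coordinate) of a sequence of copulas to
a copula: for almost every `v`, the probability measures `K_{C_n}(v, ·)` converge weakly to
`K_C(v, ·)`. -/
def WeakCondTendsto {d : ℕ} (Cn : ℕ → (Fin (d + 1) → I) → ℝ) (C : (Fin (d + 1) → I) → ℝ) : Prop :=
  (∀ n, IsCopula (Cn n)) ∧ IsCopula C ∧
    ∀ᵐ v : I, Tendsto (fun n => copulaCondLaw (Cn n) v) atTop (𝓝 (copulaCondLaw C v))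

/-- The uniform distance `d_∞`. -/
noncomputable def copulaDInf {d : ℕ} (C₁ C₂ : (Fin d → I) → ℝ) : ℝ :=
  ⨆ u : Fin d → I, |C₁ u - C₂ u|

/-- The bivariate margin `C₁₃` of a trivariate copula. -/
def margin13 (C : (Fin 3 → I) → ℝ) : (Fin 2 → I) → ℝ := fun u => C ![u 0, 1, u 1]

/-- The bivariate margin `C₂₃` of a trivariate copula. -/
def margin23 (C : (Fin 3 → I) → ℝ) : (Fin 2 → I) → ℝ := fun u => C ![1, u 0, u 1]

/-- The conditional univariate distribution functions: `condMargin C t 0` is `F_{1|3}(· | t)` and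
`condMargin C t 1` is `F_{2|3}(· | t)`, the marginal distribution functions of `K_C(t, ·)`. -/
noncomputable def condMargin (C : (Fin 3 → I) → ℝ) (t : I) (i : Fin 2) (x : I) : I :=
  ⟨(copulaKernel C t).real {u | u i ≤ x}, measureReal_nonneg, measureReal_le_one⟩

/-- The class of trivariate copulas for which, for almost every `t`, both conditional univariate
distribution functions are continuous. (For almost every `t` the measure `K_C(t, ·)` does not charge
the set where a coordinate is `0`, so continuity on the unit interval amounts to continuity on the
real line.) -/
def IsContCondCopula (C : (Fin 3 → I) → ℝ) : Prop :=
  IsCopula C ∧ ∀ᵐ t : I, ∀ i : Fin 2, Continuous (condMargin C t i)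

open Classical in
/-- The conditional copula `C_{12;3}^t`: a bivariate copula `A` with
`K_C(t, [0, u]) = A (F_{1|3}(u₁ | t), F_{2|3}(u₂ | t))` for all `u`. If almost all conditional
univariate distribution functions are continuous, then it is unique for almost every `t`. -/
noncomputable def condCopula (C : (Fin 3 → I) → ℝ) (t : I) : (Fin 2 → I) → ℝ :=
  if h : ∃ A : (Fin 2 → I) → ℝ, IsCopula A ∧
      ∀ u : Fin 2 → I, (copulaKernel C t).real (Set.Iic u) = A (fun i => condMargin C t i (u i))
  then h.choose else 0

/-- The partial copula `C_p(s) = ∫ C_{12;3}^t(s) dt`. -/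
noncomputable def partialCopula (C : (Fin 3 → I) → ℝ) (s : Fin 2 → I) : ℝ :=
  ∫ t : I, condCopula C t s

/-- The partial vine copula
`ψ(C)(u₁, u₂, v) = ∫_{[0,v]} C_p (F_{1|3}(u₁ | t), F_{2|3}(u₂ | t)) dt`. -/
noncomputable def partialVineCopula (C : (Fin 3 → I) → ℝ) (w : Fin 3 → I) : ℝ :=
  ∫ t in Set.Iic (w 2), partialCopula C ![condMargin C t 0 (w 0), condMargin C t 1 (w 1)]

section WeakConvergence

variable {d : ℕ}

lemma tendsto_measureReal_Iic_inter {ι : Type*} {l : Filter ι} {μ : ι → Measure (Fin d → I)}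
    {ν : Measure (Fin d → I)} [∀ n, IsFiniteMeasure (μ n)] [IsFiniteMeasure ν]
    (h : ∀ u, Tendsto (fun n => (μ n).real (Set.Iic u)) l (𝓝 (ν.real (Set.Iic u))))
    (a : Fin d → I) (T : Finset (Fin d)) : ∀ b : Fin d → I,
    Tendsto (fun n => (μ n).real (Set.Iic b ∩ {u | ∀ i ∈ T, a i < u i})) l
      (𝓝 (ν.real (Set.Iic b ∩ {u | ∀ i ∈ T, a i < u i}))) := by
  classical
  have hmeas : ∀ (T : Finset (Fin d)) (b : Fin d → I),
      MeasurableSet (Set.Iic b ∩ {u | ∀ i ∈ T, a i < u i}) := by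
    intro T b
    refine measurableSet_Iic.inter ?_
    simp only [Set.ofPred_forall]
    exact Finset.measurableSet_biInter _ fun i _ =>
      measurableSet_lt measurable_const (measurable_pi_apply i)
  induction T using Finset.induction_on with
  | empty => simpa using h
  | insert j T hj ih =>
    intro b
    set b' := Function.update b j (b j ⊓ a j) with hb'
    have hb'b : b' ≤ b := by
      intro i
      by_cases hi : i = j
      · subst hi; simp [hb']
      · simp [hb', hi]
    have key : Set.Iic b ∩ {u | ∀ i ∈ insert j T, a i < u i} =
        (Set.Iic b ∩ {u | ∀ i ∈ T, a i < u i}) \ (Set.Iic b' ∩ {u | ∀ i ∈ T, a i < u i}) := by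
      ext u
      simp only [Finset.mem_insert, forall_eq_or_imp, Set.mem_inter_iff, Set.mem_Iic,
        Set.mem_ofPred_eq, Set.mem_sdiff, not_and]
      constructor
      · rintro ⟨h1, h2, h3⟩
        refine ⟨⟨h1, h3⟩, fun h4 => ?_⟩
        have := h4 j
        simp only [hb', Function.update_self, le_inf_iff] at this
        exact absurd this.2 (not_le.2 h2)
      · rintro ⟨⟨h1, h3⟩, h4⟩
        refine ⟨h1, ?_, h3⟩
        by_contra! h5
        refine h4 (fun i => ?_) h3
        by_cases hi : i = j
        · subst hi; simpa [hb'] using ⟨h1 i, h5⟩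
        · simpa [hb', hi] using h1 i
    have hsub : (Set.Iic b' ∩ {u | ∀ i ∈ T, a i < u i}) ⊆
        (Set.Iic b ∩ {u | ∀ i ∈ T, a i < u i}) :=
      Set.inter_subset_inter_left _ (Set.Iic_subset_Iic.2 hb'b)
    rw [key, measureReal_sdiff hsub (hmeas T b')]
    refine ((ih b).sub (ih b')).congr fun n => ?_
    rw [measureReal_sdiff hsub (hmeas T b')]

/-- Convergence of distribution functions at every point of the cube implies weak convergence. -/
lemma tendsto_probabilityMeasure_of_tendsto_Iic {ι : Type*} {l : Filter ι}
    [l.IsCountablyGenerated] {μ : ι → ProbabilityMeasure (Fin d → I)}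
    {ν : ProbabilityMeasure (Fin d → I)}
    (h : ∀ u, Tendsto (fun n => (μ n : Measure (Fin d → I)).real (Set.Iic u)) l
      (𝓝 ((ν : Measure (Fin d → I)).real (Set.Iic u)))) :
    Tendsto μ l (𝓝 ν) := by
  classical
  let S : Set (Set (Fin d → I)) :=
    {s | ∃ (a b : Fin d → I) (T : Finset (Fin d)), s = Set.Iic b ∩ {u | ∀ i ∈ T, a i < u i}}
  have hS : IsPiSystem S := by
    rintro _ ⟨a, b, T, rfl⟩ _ ⟨a', b', T', rfl⟩ -
    refine ⟨fun i => if i ∈ T then (if i ∈ T' then a i ⊔ a' i else a i) else a' i, b ⊓ b',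
      T ∪ T', ?_⟩
    ext u
    simp only [Set.mem_inter_iff, Set.mem_Iic, Set.mem_ofPred_eq, le_inf_iff, Finset.mem_union]
    constructor
    · rintro ⟨⟨h1, h2⟩, h3, h4⟩
      refine ⟨⟨h1, h3⟩, fun i hi => ?_⟩
      by_cases hT : i ∈ T <;> by_cases hT' : i ∈ T' <;> simp_all
    · rintro ⟨⟨h1, h3⟩, h2⟩
      refine ⟨⟨h1, fun i hi => ?_⟩, h3, fun i hi => ?_⟩
      · have := h2 i (Or.inl hi)
        by_cases hT' : i ∈ T' <;> simp_all
      · have := h2 i (Or.inr hi)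
        by_cases hT : i ∈ T <;> simp_all
  refine hS.tendsto_probabilityMeasure_of_tendsto_of_mem ?_ ?_ ?_
  · rintro _ ⟨a, b, T, rfl⟩
    refine measurableSet_Iic.inter ?_
    simp only [Set.ofPred_forall]
    exact Finset.measurableSet_biInter _ fun i _ =>
      measurableSet_lt measurable_const (measurable_pi_apply i)
  · intro U hU x hx
    obtain ⟨ε, hε, hball⟩ := Metric.isOpen_iff.1 hU x hx
    have hlo : ∀ i, ∃ a : I, (x i ≠ 0 → a < x i) ∧ ∀ y, (x i ≠ 0 → a < y) → y ≤ x i →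
        dist y (x i) < ε := by
      intro i
      by_cases hxi : x i = 0
      · refine ⟨0, fun h => absurd hxi h, fun y _ hy => ?_⟩
        have : y = x i := le_antisymm hy (by rw [hxi]; exact unitInterval.nonneg')
        simpa [this] using hε
      · have h0 : (0 : I) < x i := unitInterval.pos_iff_ne_zero.2 hxi
        have h0' : (0 : ℝ) < x i := h0
        refine ⟨⟨max 0 (x i - ε / 2), le_max_left _ _, ?_⟩, fun _ => ?_, fun y hy hyx => ?_⟩
        · exact max_le zero_le_one (by linarith [(x i).2.2])
        · exact Subtype.mk_lt_mk.2 (max_lt h0' (by linarith))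
        · have h1 : max 0 ((x i : ℝ) - ε / 2) < (y : ℝ) := hy hxi
          have h2 : (y : ℝ) ≤ x i := hyx
          rw [Subtype.dist_eq, Real.dist_eq, abs_lt]
          constructor <;> linarith [le_max_right (0 : ℝ) ((x i : ℝ) - ε / 2)]
    have hhi : ∀ i, ∃ b : I, x i ≤ b ∧ Set.Iic b ∈ 𝓝 (x i) ∧
        ∀ y, x i ≤ y → y ≤ b → dist y (x i) < ε := by
      intro i
      refine ⟨⟨min 1 (x i + ε / 2), le_min zero_le_one (by linarith [(x i).2.1]),
        min_le_left _ _⟩, ?_, ?_, fun y hxy hy => ?_⟩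
      · exact Subtype.mk_le_mk.2 (le_min (x i).2.2 (by linarith))
      · have : {y : I | (y : ℝ) < x i + ε / 2} ∈ 𝓝 (x i) :=
          (isOpen_lt continuous_subtype_val continuous_const).mem_nhds (by
            simp only [Set.mem_ofPred_eq]; linarith)
        refine mem_of_superset this fun y hy => ?_
        have hy' : (y : ℝ) < x i + ε / 2 := hy
        exact show (y : ℝ) ≤ min 1 ((x i : ℝ) + ε / 2) from le_min y.2.2 hy'.le
      · have h1 : (y : ℝ) ≤ min 1 ((x i : ℝ) + ε / 2) := hy
        have h2 : (x i : ℝ) ≤ y := hxy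
        rw [Subtype.dist_eq, Real.dist_eq, abs_lt]
        constructor <;> linarith [min_le_right (1 : ℝ) ((x i : ℝ) + ε / 2)]
    choose a ha1 ha2 using hlo
    choose b hb1 hb2 hb3 using hhi
    let T : Finset (Fin d) := Finset.univ.filter fun i => x i ≠ 0
    refine ⟨_, ⟨a, b, T, rfl⟩, ?_, ?_⟩
    · refine inter_mem ?_ ?_
      · have : Set.Iic b = Set.univ.pi fun i => Set.Iic (b i) := by
          rw [Set.pi_univ_Iic]
        rw [this]
        exact set_pi_mem_nhds Set.finite_univ fun i _ => hb2 i
      · have : IsOpen {u : Fin d → I | ∀ i ∈ T, a i < u i} := by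
          simp only [Set.ofPred_forall]
          exact isOpen_biInter_finset fun i _ => isOpen_lt continuous_const (continuous_apply i)
        refine this.mem_nhds fun i hi => ha1 i (by simpa [T] using hi)
    · rintro y ⟨hy1, hy2⟩
      refine hball ?_
      rw [Metric.mem_ball, dist_pi_lt_iff hε]
      intro i
      rcases le_total (y i) (x i) with hyx | hyx
      · exact ha2 i (y i) (fun hxi => hy2 i (by simpa [T] using hxi)) hyx
      · exact hb3 i (y i) hyx (hy1 i)
  · rintro _ ⟨a, b, T, rfl⟩
    have := tendsto_measureReal_Iic_inter h a T b
    rw [← NNReal.tendsto_coe]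
    exact this

lemma probabilityMeasure_ext_of_Iic {μ ν : Measure (Fin d → I)} [hμ : IsProbabilityMeasure μ]
    [hν : IsProbabilityMeasure ν] (h : ∀ u, μ.real (Set.Iic u) = ν.real (Set.Iic u)) : μ = ν := by
  let μ' : ProbabilityMeasure (Fin d → I) := ⟨μ, hμ⟩
  let ν' : ProbabilityMeasure (Fin d → I) := ⟨ν, hν⟩
  have hlim : Tendsto (fun _ : ℕ => μ') atTop (𝓝 ν') :=
    tendsto_probabilityMeasure_of_tendsto_Iic fun u => by
      change Tendsto (fun _ => μ.real (Set.Iic u)) _ (𝓝 (ν.real (Set.Iic u)))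
      rw [h]
      exact tendsto_const_nhds
  have heq : μ' = ν' := tendsto_nhds_unique tendsto_const_nhds hlim
  exact congrArg (fun ρ : ProbabilityMeasure (Fin d → I) => (ρ : Measure (Fin d → I))) heq

end WeakConvergence

section MarginCDF

variable {d : ℕ} (μ : Measure (Fin d → I)) [IsProbabilityMeasure μ]

/-- The distribution function of the `i`-th margin of a probability measure on the unit cube. -/
noncomputable def marginCDF (i : Fin d) (x : I) : I :=
  ⟨μ.real {u | u i ≤ x}, measureReal_nonneg, measureReal_le_one⟩

/-- The quantile function of the `i`-th margin of a probability measure on the unit cube. -/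
noncomputable def marginQuantile (i : Fin d) (s : I) : I := sInf {x | s ≤ marginCDF μ i x}

lemma coe_marginCDF (i : Fin d) (x : I) : (marginCDF μ i x : ℝ) = μ.real {u | u i ≤ x} := rfl

lemma measurableSet_apply_le (i : Fin d) (x : I) : MeasurableSet {u : Fin d → I | u i ≤ x} :=
  measurableSet_le (measurable_pi_apply i) measurable_const

lemma ofReal_marginCDF (i : Fin d) (x : I) :
    ENNReal.ofReal (marginCDF μ i x) = μ {u | u i ≤ x} := by
  rw [coe_marginCDF, ofReal_measureReal]

lemma monotone_marginCDF (i : Fin d) : Monotone (marginCDF μ i) := fun _ _ hxy =>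
  Subtype.mk_le_mk.2 (measureReal_mono fun _ (hu : _ ≤ _) => hu.trans hxy)

lemma marginCDF_one (i : Fin d) : marginCDF μ i 1 = 1 := by
  refine Subtype.ext ?_
  have : {u : Fin d → I | u i ≤ 1} = Set.univ := Set.eq_univ_of_forall fun u => unitInterval.le_one'
  rw [coe_marginCDF, this]
  simp

lemma measureReal_lt_apply_le (i : Fin d) {x y : I} (hxy : x ≤ y) :
    μ.real {u | x < u i ∧ u i ≤ y} = marginCDF μ i y - marginCDF μ i x := by
  rw [coe_marginCDF, coe_marginCDF, ← measureReal_sdiff _ (measurableSet_apply_le i x)]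
  · congr 1
    ext u
    simp [and_comm]
  · exact fun u (hu : u i ≤ x) => hu.trans hxy

lemma le_marginCDF_sInf (i : Fin d) {s : I} {A : Set I} (hA : ∀ x ∈ A, s ≤ marginCDF μ i x) :
    s ≤ marginCDF μ i (sInf A) := by
  by_cases hmem : sInf A ∈ A
  · exact hA _ hmem
  rcases A.eq_empty_or_nonempty with rfl | hne
  · rw [sInf_empty]
    exact le_of_le_of_eq unitInterval.le_one' (marginCDF_one μ i).symm
  obtain ⟨x, hx_anti, hx_lt, hx_lim, hxA⟩ :=
    (isGLB_sInf A).exists_seq_strictAnti_tendsto_of_notMem hmem hne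
  have hlim : Tendsto (fun n => μ.real {u | u i ≤ x n}) atTop (𝓝 (μ.real {u | u i ≤ sInf A})) := by
    have hInter : {u : Fin d → I | u i ≤ sInf A} = ⋂ n, {u | u i ≤ x n} := by
      ext u
      simp only [Set.mem_ofPred_eq, Set.mem_iInter]
      exact ⟨fun h n => h.trans (hx_lt n).le, fun h => ge_of_tendsto' hx_lim h⟩
    rw [hInter]
    refine (ENNReal.tendsto_toReal (measure_ne_top _ _)).comp ?_
    refine tendsto_measure_iInter_atTop (fun n => (measurableSet_apply_le i _).nullMeasurableSet)
      (fun m n hmn u (hu : u i ≤ x n) => hu.trans (hx_anti.antitone hmn))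
      ⟨0, measure_ne_top _ _⟩
  exact Subtype.coe_le_coe.1 (ge_of_tendsto' hlim fun n => Subtype.coe_le_coe.2 (hA _ (hxA n)))

lemma marginQuantile_le_iff (i : Fin d) (s x : I) :
    marginQuantile μ i s ≤ x ↔ s ≤ marginCDF μ i x :=
  ⟨fun h => (le_marginCDF_sInf μ i fun _ hy => hy).trans (monotone_marginCDF μ i h),
    fun h => sInf_le h⟩

variable {μ}

lemma measure_apply_eq_zero_of_continuous {i : Fin d} (hc : Continuous (marginCDF μ i))
    (h0 : marginCDF μ i 0 = 0) (x : I) : μ {u | u i = x} = 0 := by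
  rw [← measureReal_eq_zero_iff]
  refine le_antisymm ?_ measureReal_nonneg
  rcases eq_or_ne x 0 with rfl | hx
  · have := congrArg (Subtype.val) h0
    rw [coe_marginCDF] at this
    rw [← Set.Icc.coe_zero, ← this]
    exact measureReal_mono fun u hu => le_of_eq hu
  · have h0x : (0 : I) < x := unitInterval.pos_iff_ne_zero.2 hx
    have hne : (𝓝[<] x).NeBot := nhdsLT_neBot_of_exists_lt ⟨0, h0x⟩
    have hlim : Tendsto (fun y => (marginCDF μ i x : ℝ) - marginCDF μ i y) (𝓝[<] x) (𝓝 0) := by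
      have : Tendsto (fun y => (marginCDF μ i x : ℝ) - marginCDF μ i y) (𝓝 x)
          (𝓝 ((marginCDF μ i x : ℝ) - marginCDF μ i x)) :=
        tendsto_const_nhds.sub ((continuous_subtype_val.comp hc).tendsto x)
      rw [sub_self] at this
      exact this.mono_left nhdsWithin_le_nhds
    refine ge_of_tendsto hlim ?_
    filter_upwards [self_mem_nhdsWithin] with y hy
    rw [← measureReal_lt_apply_le μ i (le_of_lt hy)]
    refine measureReal_mono fun u hu => ?_
    rw [Set.mem_ofPred_eq] at hu
    exact ⟨hu ▸ hy, hu.le⟩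

lemma surjective_marginCDF {i : Fin d} (hc : Continuous (marginCDF μ i))
    (h0 : marginCDF μ i 0 = 0) : Function.Surjective (marginCDF μ i) := by
  intro s
  have := intermediate_value_univ (0 : I) 1 hc
  rw [h0, marginCDF_one] at this
  exact this ⟨unitInterval.nonneg', unitInterval.le_one'⟩

lemma ae_marginCDF_le_iff {i : Fin d} (hc : Continuous (marginCDF μ i)) (x : I) :
    ∀ᵐ u ∂μ, marginCDF μ i (u i) ≤ marginCDF μ i x ↔ u i ≤ x := by
  have hK : IsCompact {y | marginCDF μ i y = marginCDF μ i x} :=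
    (isClosed_eq hc continuous_const).isCompact
  obtain ⟨y, hy, hmax⟩ := hK.exists_isGreatest ⟨x, rfl⟩
  have hxy : x ≤ y := hmax rfl
  have hnull : μ {u | x < u i ∧ u i ≤ y} = 0 := by
    rw [← measureReal_eq_zero_iff, measureReal_lt_apply_le μ i hxy, hy, sub_self]
  filter_upwards [measure_eq_zero_iff_ae_notMem.1 hnull] with u hu
  refine ⟨fun h => ?_, fun h => monotone_marginCDF μ i h⟩
  by_contra! hlt
  exact hu ⟨hlt, hmax (le_antisymm h (monotone_marginCDF μ i hlt.le))⟩

lemma tendsto_measureReal_Iic_of_tendsto {ι : Type*} {l : Filter ι}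
    {μs : ι → ProbabilityMeasure (Fin d → I)} {ν : ProbabilityMeasure (Fin d → I)}
    (h : Tendsto μs l (𝓝 ν)) (hc : ∀ i, Continuous (marginCDF (ν : Measure (Fin d → I)) i))
    (h0 : ∀ i, marginCDF (ν : Measure (Fin d → I)) i 0 = 0) (u : Fin d → I) :
    Tendsto (fun n => (μs n : Measure (Fin d → I)).real (Set.Iic u)) l
      (𝓝 ((ν : Measure (Fin d → I)).real (Set.Iic u))) := by
  have hfr : frontier (Set.Iic u) ⊆ ⋃ i, {x : Fin d → I | x i = u i} := by
    rw [isClosed_Iic.frontier_eq]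
    rintro x ⟨hx, hx'⟩
    by_contra hcon
    simp only [Set.mem_iUnion, Set.mem_ofPred_eq, not_exists] at hcon
    refine hx' (mem_interior.2 ⟨⋂ i, {y | y i < u i}, fun y hy i => ?_, ?_, ?_⟩)
    · exact (Set.mem_iInter.1 hy i).le
    · exact isOpen_iInter_of_finite fun i => isOpen_lt (continuous_apply i) continuous_const
    · exact Set.mem_iInter.2 fun i => lt_of_le_of_ne (hx i) (hcon i)
  have hnull : (ν : Measure (Fin d → I)) (frontier (Set.Iic u)) = 0 :=
    measure_mono_null hfr (measure_iUnion_null fun i =>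
      measure_apply_eq_zero_of_continuous (hc i) (h0 i) _)
  exact (ENNReal.tendsto_toReal (measure_ne_top _ _)).comp
    (ProbabilityMeasure.tendsto_measure_of_null_frontier_of_tendsto' h hnull)

lemma setOf_apply_le_eq_Iic (i : Fin d) (x : I) :
    {u : Fin d → I | u i ≤ x} = Set.Iic (Function.update (fun _ => (1 : I)) i x) := by
  ext u
  simp only [Set.mem_ofPred_eq, Set.mem_Iic, Pi.le_def]
  constructor
  · intro h j
    by_cases hj : j = i
    · subst hj; simpa using h
    · simpa [hj] using unitInterval.le_one'
  · intro h
    simpa using h i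

lemma tendsto_marginCDF {ι : Type*} {l : Filter ι} {μs : ι → Measure (Fin d → I)}
    [∀ n, IsProbabilityMeasure (μs n)] {ν : Measure (Fin d → I)} [IsProbabilityMeasure ν]
    (h : ∀ u, Tendsto (fun n => (μs n).real (Set.Iic u)) l (𝓝 (ν.real (Set.Iic u))))
    (i : Fin d) (x : I) : Tendsto (fun n => marginCDF (μs n) i x) l (𝓝 (marginCDF ν i x)) := by
  rw [tendsto_subtype_rng]
  simp only [coe_marginCDF, setOf_apply_le_eq_Iic]
  exact h _

/-- The probability integral transform, applied coordinatewise. -/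
noncomputable def marginTransform (μ : Measure (Fin d → I)) [IsProbabilityMeasure μ]
    (u : Fin d → I) : Fin d → I := fun i => marginCDF μ i (u i)

lemma measurable_marginTransform : Measurable (marginTransform μ) :=
  measurable_pi_lambda _ fun i =>
    (monotone_marginCDF μ i).measurable.comp (measurable_pi_apply i)

lemma measure_marginTransform_apply_le {i : Fin d} (hc : Continuous (marginCDF μ i))
    (h0 : marginCDF μ i 0 = 0) (s : I) :
    μ {u | marginTransform μ u i ≤ s} = ENNReal.ofReal s := by
  obtain ⟨x, rfl⟩ := surjective_marginCDF hc h0 s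
  rw [ofReal_marginCDF]
  refine measure_congr ?_
  filter_upwards [ae_marginCDF_le_iff hc x] with u hu
  exact propext hu

lemma measureReal_Iic_eq_map_marginTransform (hc : ∀ i, Continuous (marginCDF μ i))
    (u : Fin d → I) :
    μ.real (Set.Iic u) = (μ.map (marginTransform μ)).real (Set.Iic (marginTransform μ u)) := by
  rw [map_measureReal_apply measurable_marginTransform measurableSet_Iic]
  refine measureReal_congr ?_
  filter_upwards [ae_all_iff.2 fun i => ae_marginCDF_le_iff (hc i) (u i)] with x hx
  exact propext (forall_congr' fun i => (hx i).symm)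

lemma surjective_marginTransform (hc : ∀ i, Continuous (marginCDF μ i))
    (h0 : ∀ i, marginCDF μ i 0 = 0) : Function.Surjective (marginTransform μ) := by
  intro s
  choose u hu using fun i => surjective_marginCDF (hc i) (h0 i) (s i)
  exact ⟨u, funext hu⟩

end MarginCDF

section Copula

variable {d : ℕ}

lemma IsStochasticMeasure.measure_apply_le {μ : Measure (Fin d → I)} (h : IsStochasticMeasure μ)
    (i : Fin d) (x : I) : μ {u | u i ≤ x} = ENNReal.ofReal x := by
  rw [← unitInterval.volume_Iic, ← h.map_eval i,
    Measure.map_apply (measurable_pi_apply i) measurableSet_Iic]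
  rfl

lemma isStochasticMeasure_of_measure_apply_le {μ : Measure (Fin d → I)} [hμ : IsProbabilityMeasure μ]
    (h : ∀ i x, μ {u | u i ≤ x} = ENNReal.ofReal (x : I)) : IsStochasticMeasure μ where
  isProbabilityMeasure := hμ
  map_eval i := by
    have : IsProbabilityMeasure (μ.map fun u => u i) :=
      Measure.isProbabilityMeasure_map (measurable_pi_apply i).aemeasurable
    refine Measure.ext_of_Iic _ _ fun x => ?_
    rw [unitInterval.volume_Iic, ← h i x,
      Measure.map_apply (measurable_pi_apply i) measurableSet_Iic]
    rfl

lemma isStochasticMeasure_map_marginTransform {μ : Measure (Fin d → I)} [IsProbabilityMeasure μ]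
    (hc : ∀ i, Continuous (marginCDF μ i)) (h0 : ∀ i, marginCDF μ i 0 = 0) :
    IsStochasticMeasure (μ.map (marginTransform μ)) := by
  have : IsProbabilityMeasure (μ.map (marginTransform μ)) :=
    Measure.isProbabilityMeasure_map measurable_marginTransform.aemeasurable
  refine isStochasticMeasure_of_measure_apply_le fun i x => ?_
  rw [Measure.map_apply measurable_marginTransform (measurableSet_apply_le i x)]
  exact measure_marginTransform_apply_le (hc i) (h0 i) x

lemma IsCopula.isStochasticMeasure {C : (Fin d → I) → ℝ} (hC : IsCopula C) :
    IsStochasticMeasure (copulaMeasure C) := by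
  rw [copulaMeasure, dif_pos hC]
  exact hC.choose_spec.1

lemma IsCopula.apply_eq {C : (Fin d → I) → ℝ} (hC : IsCopula C) (u : Fin d → I) :
    C u = (copulaMeasure C).real (Set.Iic u) := by
  rw [copulaMeasure, dif_pos hC]
  exact hC.choose_spec.2 u

lemma copulaMeasure_eq {C : (Fin d → I) → ℝ} {μ : Measure (Fin d → I)}
    (hμ : IsStochasticMeasure μ) (h : ∀ u, C u = μ.real (Set.Iic u)) : copulaMeasure C = μ := by
  have hC : IsCopula C := ⟨μ, hμ, h⟩
  have := hμ.isProbabilityMeasure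
  have := hC.isStochasticMeasure.isProbabilityMeasure
  exact probabilityMeasure_ext_of_Iic fun u => by rw [← hC.apply_eq, h]

lemma IsStochasticMeasure.measureReal_Iic_sub_le {μ : Measure (Fin d → I)}
    (h : IsStochasticMeasure μ) (s t : Fin d → I) :
    μ.real (Set.Iic s) - μ.real (Set.Iic t) ≤ d * dist s t := by
  have := h.isProbabilityMeasure
  have hsub : Set.Iic s ⊆ Set.Iic t ∪ ⋃ i, {u | u i ∈ Set.Ioc (t i) (s i)} := by
    intro u hu
    by_cases hut : u ≤ t
    · exact Or.inl hut
    · obtain ⟨i, hi⟩ := not_forall.1 hut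
      exact Or.inr (Set.mem_iUnion.2 ⟨i, not_le.1 hi, hu i⟩)
  have hi : ∀ i, μ.real {u | u i ∈ Set.Ioc (t i) (s i)} ≤ dist s t := by
    intro i
    have : μ {u | u i ∈ Set.Ioc (t i) (s i)} = ENNReal.ofReal (s i - t i) := by
      rw [← unitInterval.volume_Ioc, ← h.map_eval i,
        Measure.map_apply (measurable_pi_apply i) measurableSet_Ioc]
      rfl
    rw [measureReal_def, this]
    refine ENNReal.toReal_le_of_le_ofReal dist_nonneg (ENNReal.ofReal_le_ofReal ?_)
    refine (le_abs_self _).trans (le_trans (le_of_eq ?_) (dist_le_pi_dist s t i))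
    rw [Subtype.dist_eq, Real.dist_eq]
  have h1 := (measureReal_mono hsub (measure_ne_top μ _)).trans (measureReal_union_le _ _)
  have h2 : μ.real (⋃ i, {u | u i ∈ Set.Ioc (t i) (s i)}) ≤ d * dist s t := by
    refine (measureReal_iUnion_fintype_le _).trans ?_
    refine (Finset.sum_le_sum fun i _ => hi i).trans (le_of_eq ?_)
    simp
  linarith

lemma IsCopula.lipschitzWith {C : (Fin d → I) → ℝ} (hC : IsCopula C) : LipschitzWith d C := by
  refine LipschitzWith.of_dist_le_mul fun s t => ?_
  rw [Real.dist_eq, abs_sub_le_iff, hC.apply_eq, hC.apply_eq]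
  refine ⟨hC.isStochasticMeasure.measureReal_Iic_sub_le s t, ?_⟩
  rw [dist_comm]
  exact hC.isStochasticMeasure.measureReal_Iic_sub_le t s

lemma tendsto_dist_copula_of_tendsto {ι : Type*} {l : Filter ι} {A : ι → (Fin d → I) → ℝ}
    (hA : ∀ n, IsCopula (A n)) {s : ι → Fin d → I} {s₀ : Fin d → I} (hs : Tendsto s l (𝓝 s₀)) :
    Tendsto (fun n => dist (A n (s n)) (A n s₀)) l (𝓝 0) := by
  have h : Tendsto (fun n => (d : ℝ) * dist (s n) s₀) l (𝓝 0) := by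
    simpa using (tendsto_iff_dist_tendsto_zero.1 hs).const_mul (d : ℝ)
  exact squeeze_zero (fun _ => dist_nonneg)
    (fun n => by simpa using (hA n).lipschitzWith.dist_le_mul (s n) s₀) h

/-- Pointwise convergence of copulas is uniform. -/
lemma tendsto_copulaDInf_of_tendsto {A : ℕ → (Fin d → I) → ℝ} {B : (Fin d → I) → ℝ}
    (hA : ∀ n, IsCopula (A n)) (h : ∀ s, Tendsto (fun n => A n s) atTop (𝓝 (B s))) :
    Tendsto (fun n => copulaDInf (A n) B) atTop (𝓝 0) := by
  have heq : Equicontinuous A :=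
    (LipschitzWith.uniformEquicontinuous A d fun n => (hA n).lipschitzWith).equicontinuous
  have hunif := (heq.tendsto_uniformFun_iff_pi atTop B).2 (tendsto_pi_nhds.2 h)
  rw [UniformFun.tendsto_iff_tendstoUniformly, Metric.tendstoUniformly_iff] at hunif
  rw [Metric.tendsto_atTop]
  intro ε hε
  obtain ⟨N, hN⟩ := eventually_atTop.1 (hunif (ε / 2) (half_pos hε))
  refine ⟨N, fun n hn => ?_⟩
  rw [Real.dist_0_eq_abs, copulaDInf, abs_of_nonneg (Real.iSup_nonneg fun _ => abs_nonneg _)]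
  refine lt_of_le_of_lt (ciSup_le fun u => ?_) (half_lt_self hε)
  have := hN n hn u
  rw [dist_comm, Real.dist_eq] at this
  exact this.le

end Copula

section CopulaKernel

variable {d : ℕ}

lemma piFinSuccAbove_last_apply (u : Fin (d + 1) → I) :
    MeasurableEquiv.piFinSuccAbove (fun _ => I) (Fin.last d) u =
      (u (Fin.last d), fun i => u i.castSucc) := by
  refine Prod.ext rfl (funext fun i => ?_)
  change u ((Fin.last d).succAbove i) = _
  rw [Fin.succAbove_last]

lemma IsCopula.map_eq_compProd {C : (Fin (d + 1) → I) → ℝ} (hC : IsCopula C) :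
    (copulaMeasure C).map (MeasurableEquiv.piFinSuccAbove (fun _ => I) (Fin.last d)) =
      volume ⊗ₘ copulaKernel C := by
  set e := MeasurableEquiv.piFinSuccAbove (fun _ => I) (Fin.last d)
  have hfst : ((copulaMeasure C).map e).fst = volume := by
    rw [Measure.fst, Measure.map_map measurable_fst e.measurable]
    exact hC.isStochasticMeasure.map_eval (Fin.last d)
  have h := ((copulaMeasure C).map e).disintegrate ((copulaMeasure C).map e).condKernel
  rw [hfst] at h
  exact h.symm

lemma compProd_Iic_prod (κ : Kernel I (Fin d → I)) [IsMarkovKernel κ] (x : I)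
    {s : Set (Fin d → I)} (hs : MeasurableSet s) :
    (volume ⊗ₘ κ).real (Set.Iic x ×ˢ s) = ∫ t in Set.Iic x, (κ t).real s := by
  rw [measureReal_def, Measure.compProd_apply_prod measurableSet_Iic hs]
  simp only [measureReal_def]
  rw [integral_toReal (κ.measurable_coe hs).aemeasurable
    (ae_of_all _ fun t => measure_lt_top _ _)]

lemma preimage_piFinSuccAbove_last_Iic (w : Fin (d + 1) → I) :
    MeasurableEquiv.piFinSuccAbove (fun _ => I) (Fin.last d) ⁻¹'
      (Set.Iic (w (Fin.last d)) ×ˢ Set.Iic fun i => w i.castSucc) = Set.Iic w := by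
  ext u
  rw [Set.mem_preimage, piFinSuccAbove_last_apply, Set.mem_prod, Set.mem_Iic, Set.mem_Iic,
    Set.mem_Iic, Pi.le_def, Pi.le_def, Fin.forall_fin_succ', and_comm]

lemma IsCopula.apply_eq_setIntegral {C : (Fin (d + 1) → I) → ℝ} (hC : IsCopula C)
    (w : Fin (d + 1) → I) :
    C w = ∫ t in Set.Iic (w (Fin.last d)),
      (copulaKernel C t).real (Set.Iic fun i => w i.castSucc) := by
  rw [← compProd_Iic_prod _ _ measurableSet_Iic, ← hC.map_eq_compProd,
    map_measureReal_apply (MeasurableEquiv.measurable _) (measurableSet_Iic.prod measurableSet_Iic),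
    preimage_piFinSuccAbove_last_Iic, hC.apply_eq]

lemma IsCopula.lintegral_copulaKernel_apply_le {C : (Fin (d + 1) → I) → ℝ} (hC : IsCopula C)
    (i : Fin d) (x : I) : ∫⁻ t, copulaKernel C t {u | u i ≤ x} = ENNReal.ofReal x := by
  have hms := measurableSet_apply_le i x
  rw [← hC.isStochasticMeasure.measure_apply_le i.castSucc x, ← setLIntegral_univ,
    ← Measure.compProd_apply_prod MeasurableSet.univ hms, ← hC.map_eq_compProd,
    Measure.map_apply (MeasurableEquiv.measurable _) (MeasurableSet.univ.prod hms)]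
  congr 1
  ext u
  rw [Set.mem_preimage, piFinSuccAbove_last_apply]
  simp

/-- Integrating a Markov kernel whose mixture has uniform margins gives a copula with that
kernel. -/
lemma isCopula_and_copulaKernel_ae_eq {C : (Fin (d + 1) → I) → ℝ} (κ : Kernel I (Fin d → I))
    [IsMarkovKernel κ] (hκ : ∀ i x, ∫⁻ t, κ t {u | u i ≤ x} = ENNReal.ofReal (x : I))
    (hC : ∀ w, C w = ∫ t in Set.Iic (w (Fin.last d)), (κ t).real (Set.Iic fun i => w i.castSucc)) :
    IsCopula C ∧ ∀ᵐ t : I, copulaKernel C t = κ t := by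
  set e := MeasurableEquiv.piFinSuccAbove (fun _ => I) (Fin.last d) with he
  set μ : Measure (Fin (d + 1) → I) := (volume ⊗ₘ κ).map e.symm with hμ
  have hμe : μ.map e = volume ⊗ₘ κ := by
    rw [hμ, Measure.map_map e.measurable e.symm.measurable]
    simp
  have hμp : IsProbabilityMeasure μ :=
    Measure.isProbabilityMeasure_map e.symm.measurable.aemeasurable
  have hst : IsStochasticMeasure μ := by
    refine isStochasticMeasure_of_measure_apply_le fun i x => ?_
    induction i using Fin.lastCases with
    | last =>
      rw [← unitInterval.volume_Iic]
      have : {u : Fin (d + 1) → I | u (Fin.last d) ≤ x} = e ⁻¹' (Set.Iic x ×ˢ Set.univ) := by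
        ext u
        rw [Set.mem_preimage, he, piFinSuccAbove_last_apply]
        simp
      rw [this, ← Measure.map_apply e.measurable (measurableSet_Iic.prod MeasurableSet.univ), hμe,
        Measure.compProd_apply_prod measurableSet_Iic MeasurableSet.univ]
      simp
    | cast i =>
      rw [← hκ i x]
      have hms := measurableSet_apply_le i x
      have : {u : Fin (d + 1) → I | u i.castSucc ≤ x} =
          e ⁻¹' (Set.univ ×ˢ {u : Fin d → I | u i ≤ x}) := by
        ext u
        rw [Set.mem_preimage, he, piFinSuccAbove_last_apply]
        simp
      rw [this, ← Measure.map_apply e.measurable (MeasurableSet.univ.prod hms), hμe,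
        Measure.compProd_apply_prod MeasurableSet.univ hms, setLIntegral_univ]
  have hCμ : ∀ w, C w = μ.real (Set.Iic w) := by
    intro w
    rw [hC, ← compProd_Iic_prod _ _ measurableSet_Iic, ← hμe,
      map_measureReal_apply e.measurable (measurableSet_Iic.prod measurableSet_Iic),
      preimage_piFinSuccAbove_last_Iic]
  refine ⟨⟨μ, hst, hCμ⟩, ?_⟩
  have hcond : copulaKernel C = (volume ⊗ₘ κ).condKernel := by
    simp only [copulaKernel, copulaMeasure_eq hst hCμ, ← he, hμe]
  rw [hcond]
  exact condKernel_compProd volume κ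

end CopulaKernel

section JointMeasurability

variable {d : ℕ} (κ : Kernel I (Fin d → I)) [IsMarkovKernel κ]

lemma measurable_marginCDF_uncurry (i : Fin d) :
    Measurable fun p : I × I => marginCDF (κ p.1) i p.2 := by
  have hS : MeasurableSet {q : (I × I) × (Fin d → I) | q.2 i ≤ q.1.2} :=
    measurableSet_le ((measurable_pi_apply i).comp measurable_snd) measurable_fst.snd
  have h := Kernel.measurable_kernel_prodMk_left (κ := κ.comap Prod.fst measurable_fst) hS
  exact h.ennreal_toReal.subtype_mk

lemma measurable_marginTransform_uncurry :
    Measurable fun p : I × (Fin d → I) => marginTransform (κ p.1) p.2 :=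
  measurable_pi_lambda _ fun i => (measurable_marginCDF_uncurry κ i).comp
    (measurable_fst.prodMk ((measurable_pi_apply i).comp measurable_snd))

lemma measurable_marginQuantile_uncurry (i : Fin d) :
    Measurable fun p : I × I => marginQuantile (κ p.1) i p.2 := by
  refine measurable_of_Iic fun x => ?_
  have : (fun p : I × I => marginQuantile (κ p.1) i p.2) ⁻¹' Set.Iic x =
      {p | p.2 ≤ marginCDF (κ p.1) i x} := by
    ext p
    exact marginQuantile_le_iff _ _ _ _
  rw [this]
  exact measurableSet_le measurable_snd
    ((measurable_marginCDF_uncurry κ i).comp (measurable_fst.prodMk measurable_const))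

/-- The map applying the quantile functions of the margins of `κ t` coordinatewise. -/
noncomputable def quantileTransform (p : I × (Fin d → I)) : Fin d → I :=
  fun i => marginQuantile (κ p.1) i (p.2 i)

lemma measurable_quantileTransform : Measurable (quantileTransform κ) :=
  measurable_pi_lambda _ fun i => (measurable_marginQuantile_uncurry κ i).comp
    (measurable_fst.prodMk ((measurable_pi_apply i).comp measurable_snd))

/-- The law of the conditional probability integral transforms. -/
noncomputable def partialMeasure : Measure (Fin d → I) :=
  (volume ⊗ₘ κ).map fun p => marginTransform (κ p.1) p.2

lemma partialMeasure_apply {s : Set (Fin d → I)} (hs : MeasurableSet s) :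
    partialMeasure κ s = ∫⁻ t, κ t (marginTransform (κ t) ⁻¹' s) := by
  rw [partialMeasure, Measure.map_apply (measurable_marginTransform_uncurry κ) hs,
    Measure.compProd_apply (measurable_marginTransform_uncurry κ hs)]
  rfl

instance : IsProbabilityMeasure (partialMeasure κ) :=
  Measure.isProbabilityMeasure_map (measurable_marginTransform_uncurry κ).aemeasurable

lemma partialMeasure_real_apply {s : Set (Fin d → I)} (hs : MeasurableSet s) :
    (partialMeasure κ).real s = ∫ t, (κ t).real (marginTransform (κ t) ⁻¹' s) := by
  rw [measureReal_def, partialMeasure_apply κ hs]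
  simp only [measureReal_def]
  rw [integral_toReal _ (ae_of_all _ fun t => measure_lt_top _ _)]
  exact (Kernel.measurable_kernel_prodMk_left
    (measurable_marginTransform_uncurry κ hs)).aemeasurable

/-- The kernel `t ↦` law of a vector with copula measure `ν` and the margins of `κ t`. -/
noncomputable def vineKernel (ν : Measure (Fin d → I)) [SFinite ν] : Kernel I (Fin d → I) :=
  (Kernel.id ×ₖ Kernel.const I ν).map (quantileTransform κ)

instance (ν : Measure (Fin d → I)) [IsProbabilityMeasure ν] : IsMarkovKernel (vineKernel κ ν) :=
  Kernel.IsMarkovKernel.map _ (measurable_quantileTransform κ)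

variable (ν : Measure (Fin d → I)) [IsProbabilityMeasure ν]

lemma vineKernel_apply' (t : I) {s : Set (Fin d → I)} (hs : MeasurableSet s) :
    vineKernel κ ν t s = ν {x | quantileTransform κ (t, x) ∈ s} := by
  rw [vineKernel, Kernel.map_apply' _ (measurable_quantileTransform κ) _ hs, Kernel.prod_apply,
    Kernel.id_apply, Kernel.const_apply, Measure.dirac_prod,
    Measure.map_apply measurable_prodMk_left (measurable_quantileTransform κ hs)]
  rfl

lemma vineKernel_real_Iic (t : I) (u : Fin d → I) :
    (vineKernel κ ν t).real (Set.Iic u) = ν.real (Set.Iic (marginTransform (κ t) u)) := by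
  rw [measureReal_def, vineKernel_apply' κ ν t measurableSet_Iic, ← measureReal_def]
  congr 1
  ext x
  exact forall_congr' fun i => marginQuantile_le_iff _ _ _ _

lemma marginCDF_vineKernel {ρ : Measure (Fin d → I)} [IsProbabilityMeasure ρ]
    (hρ : IsStochasticMeasure ρ) (t : I) (i : Fin d) :
    marginCDF (vineKernel κ ρ t) i = marginCDF (κ t) i := by
  ext x
  rw [coe_marginCDF, measureReal_def, vineKernel_apply' κ ρ t (measurableSet_apply_le i x)]
  have : {y | quantileTransform κ (t, y) ∈ {u : Fin d → I | u i ≤ x}} =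
      {y | y i ≤ marginCDF (κ t) i x} := by
    ext y
    exact marginQuantile_le_iff _ _ _ _
  rw [this, hρ.measure_apply_le, ENNReal.toReal_ofReal unitInterval.nonneg']

end JointMeasurability

section Trivariate

variable {C : (Fin 3 → I) → ℝ}

lemma IsContCondCopula.ae_continuous_and_zero (hC : IsContCondCopula C) :
    ∀ᵐ t : I, (∀ i, Continuous (marginCDF (copulaKernel C t) i)) ∧
      ∀ i, marginCDF (copulaKernel C t) i 0 = 0 := by
  have h0 : ∀ i : Fin 2, ∀ᵐ t : I, copulaKernel C t {u | u i ≤ 0} = 0 := by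
    intro i
    refine (lintegral_eq_zero_iff ((copulaKernel C).measurable_coe
      (measurableSet_apply_le i 0))).1 ?_
    rw [hC.1.lintegral_copulaKernel_apply_le]
    simp
  filter_upwards [hC.2, ae_all_iff.2 h0] with t h1 h2
  refine ⟨h1, fun i => Subtype.ext ?_⟩
  rw [coe_marginCDF, measureReal_def, h2 i]
  rfl

lemma condCopula_eq {t : I} (hc : ∀ i, Continuous (marginCDF (copulaKernel C t) i))
    (h0 : ∀ i, marginCDF (copulaKernel C t) i 0 = 0) (s : Fin 2 → I) :
    condCopula C t s =
      ((copulaKernel C t).map (marginTransform (copulaKernel C t))).real (Set.Iic s) := by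
  have hst := isStochasticMeasure_map_marginTransform hc h0
  have hex : ∃ A : (Fin 2 → I) → ℝ, IsCopula A ∧ ∀ u : Fin 2 → I,
      (copulaKernel C t).real (Set.Iic u) = A (fun i => condMargin C t i (u i)) :=
    ⟨_, ⟨_, hst, fun _ => rfl⟩, measureReal_Iic_eq_map_marginTransform hc⟩
  obtain ⟨u, rfl⟩ := surjective_marginTransform hc h0 s
  rw [condCopula, dif_pos hex, ← measureReal_Iic_eq_map_marginTransform hc]
  exact (hex.choose_spec.2 u).symm

lemma condCopula_marginTransform {t : I} (hc : ∀ i, Continuous (marginCDF (copulaKernel C t) i))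
    (h0 : ∀ i, marginCDF (copulaKernel C t) i 0 = 0) (u : Fin 2 → I) :
    condCopula C t (marginTransform (copulaKernel C t) u) =
      (copulaKernel C t).real (Set.Iic u) := by
  rw [condCopula_eq hc h0, measureReal_Iic_eq_map_marginTransform hc]

lemma isCopula_condCopula {t : I} (hc : ∀ i, Continuous (marginCDF (copulaKernel C t) i))
    (h0 : ∀ i, marginCDF (copulaKernel C t) i 0 = 0) : IsCopula (condCopula C t) :=
  ⟨_, isStochasticMeasure_map_marginTransform hc h0, condCopula_eq hc h0⟩

lemma IsContCondCopula.condCopula_ae_eq (hC : IsContCondCopula C) (s : Fin 2 → I) :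
    (fun t => condCopula C t s) =ᵐ[volume] fun t => (copulaKernel C t).real
      (marginTransform (copulaKernel C t) ⁻¹' Set.Iic s) := by
  filter_upwards [hC.ae_continuous_and_zero] with t ht
  rw [condCopula_eq ht.1 ht.2, map_measureReal_apply measurable_marginTransform measurableSet_Iic]

lemma IsContCondCopula.isCopula_partialCopula (hC : IsContCondCopula C) :
    IsCopula (partialCopula C) := by
  refine ⟨partialMeasure (copulaKernel C), isStochasticMeasure_of_measure_apply_le fun i x => ?_,
    fun s => ?_⟩
  · rw [partialMeasure_apply _ (measurableSet_apply_le i x)]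
    rw [lintegral_congr_ae (g := fun _ => ENNReal.ofReal x), lintegral_const, measure_univ,
      mul_one]
    filter_upwards [hC.ae_continuous_and_zero] with t ht
    exact measure_marginTransform_apply_le (ht.1 i) (ht.2 i) x
  · rw [partialCopula, partialMeasure_real_apply _ measurableSet_Iic]
    exact integral_congr_ae (hC.condCopula_ae_eq s)

lemma IsContCondCopula.aestronglyMeasurable_condCopula (hC : IsContCondCopula C)
    (s : Fin 2 → I) : AEStronglyMeasurable (fun t => condCopula C t s) volume := by
  refine AEStronglyMeasurable.congr ?_ (hC.condCopula_ae_eq s).symm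
  exact (Kernel.measurable_kernel_prodMk_left (measurable_marginTransform_uncurry (copulaKernel C)
    measurableSet_Iic)).ennreal_toReal.aestronglyMeasurable

lemma IsContCondCopula.partialVineCopula_spec (hC : IsContCondCopula C) :
    IsContCondCopula (partialVineCopula C) ∧
      ∀ᵐ t : I, ∀ u, (copulaKernel (partialVineCopula C) t).real (Set.Iic u) =
        partialCopula C (marginTransform (copulaKernel C t) u) := by
  have hP := hC.isCopula_partialCopula
  have hst := hP.isStochasticMeasure
  have := hst.isProbabilityMeasure
  set κ := copulaKernel C with hκ
  set η := vineKernel κ (copulaMeasure (partialCopula C)) with hη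
  have hηm : ∀ t i x, η t {u | u i ≤ x} = κ t {u | u i ≤ x} := by
    intro t i x
    rw [← ofReal_marginCDF, ← ofReal_marginCDF, marginCDF_vineKernel κ hst]
  have hηu : ∀ t u, (η t).real (Set.Iic u) = partialCopula C (marginTransform (κ t) u) := by
    intro t u
    rw [vineKernel_real_Iic, hP.apply_eq]
  obtain ⟨hcop, hae⟩ := isCopula_and_copulaKernel_ae_eq (C := partialVineCopula C) η
    (fun i x => by simp only [hηm]; exact hC.1.lintegral_copulaKernel_apply_le i x)
    (fun w => by
      rw [partialVineCopula]
      refine integral_congr_ae (ae_of_all _ fun t => ?_)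
      simp only [hηu]
      congr 1
      ext i
      fin_cases i <;> rfl)
  refine ⟨⟨hcop, ?_⟩, ?_⟩
  · filter_upwards [hae, hC.2] with t ht hct i
    have : condMargin (partialVineCopula C) t i = condMargin C t i := by
      ext x
      change (copulaKernel (partialVineCopula C) t).real _ = (κ t).real _
      rw [ht, measureReal_def, hηm, measureReal_def]
    rw [this]
    exact hct i
  · filter_upwards [hae] with t ht u
    rw [ht, hηu]

lemma isCopula_and_copulaKernel_ae_eq_map (hC : IsCopula C) (j : Fin 2) {D : (Fin 2 → I) → ℝ}
    (hD : ∀ w, D w = ∫ t in Set.Iic (w 1), (copulaKernel C t).real {u | u j ≤ w 0}) :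
    IsCopula D ∧ ∀ᵐ t : I, copulaKernel D t = (copulaKernel C t).map fun u (_ : Fin 1) => u j := by
  have hm : Measurable fun (u : Fin 2 → I) (_ : Fin 1) => u j :=
    measurable_pi_lambda _ fun _ => measurable_pi_apply j
  have : IsMarkovKernel ((copulaKernel C).map fun u (_ : Fin 1) => u j) :=
    Kernel.IsMarkovKernel.map _ hm
  have h := isCopula_and_copulaKernel_ae_eq (C := D)
    ((copulaKernel C).map fun u (_ : Fin 1) => u j) (fun i x => ?_) (fun w => ?_)
  · simpa only [Kernel.map_apply _ hm] using h
  · rw [← hC.lintegral_copulaKernel_apply_le j x]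
    refine lintegral_congr fun t => ?_
    rw [Kernel.map_apply' _ hm _ (measurableSet_apply_le i x)]
    rfl
  · rw [hD]
    refine integral_congr_ae (ae_of_all _ fun t => ?_)
    simp only [Kernel.map_apply _ hm]
    rw [map_measureReal_apply hm measurableSet_Iic]
    congr 1
    ext u
    simp [Pi.le_def]

lemma margin13_eq_setIntegral (hC : IsCopula C) (w : Fin 2 → I) :
    margin13 C w = ∫ t in Set.Iic (w 1), (copulaKernel C t).real {u | u 0 ≤ w 0} := by
  rw [margin13, hC.apply_eq_setIntegral]
  have : (Set.Iic fun i : Fin 2 => ![w 0, 1, w 1] i.castSucc) = {u : Fin 2 → I | u 0 ≤ w 0} := by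
    ext u
    simp [Pi.le_def, Fin.forall_fin_two, unitInterval.le_one']
  rw [this]
  rfl

lemma margin23_eq_setIntegral (hC : IsCopula C) (w : Fin 2 → I) :
    margin23 C w = ∫ t in Set.Iic (w 1), (copulaKernel C t).real {u | u 1 ≤ w 0} := by
  rw [margin23, hC.apply_eq_setIntegral]
  have : (Set.Iic fun i : Fin 2 => ![1, w 0, w 1] i.castSucc) = {u : Fin 2 → I | u 1 ≤ w 0} := by
    ext u
    simp [Pi.le_def, Fin.forall_fin_two, unitInterval.le_one']
  rw [this]
  rfl

variable {Cn : ℕ → (Fin 3 → I) → ℝ}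

lemma WeakCondTendsto.of_margin (hconv : WeakCondTendsto Cn C) (j : Fin 2)
    {D : (Fin 2 → I) → ℝ} {Dn : ℕ → (Fin 2 → I) → ℝ}
    (hD : ∀ w, D w = ∫ t in Set.Iic (w 1), (copulaKernel C t).real {u | u j ≤ w 0})
    (hDn : ∀ n w, Dn n w = ∫ t in Set.Iic (w 1), (copulaKernel (Cn n) t).real {u | u j ≤ w 0}) :
    WeakCondTendsto Dn D := by
  obtain ⟨hCn, hC, hlim⟩ := hconv
  have h := isCopula_and_copulaKernel_ae_eq_map hC j hD
  have hn := fun n => isCopula_and_copulaKernel_ae_eq_map (hCn n) j (hDn n)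
  refine ⟨fun n => (hn n).1, h.1, ?_⟩
  filter_upwards [hlim, h.2, ae_all_iff.2 fun n => (hn n).2] with t ht h1 h2
  have hcont : Continuous fun (u : Fin 2 → I) (_ : Fin 1) => u j :=
    continuous_pi fun _ => continuous_apply j
  have key := ProbabilityMeasure.tendsto_map_of_tendsto_of_continuous _ _ ht hcont
  have e : copulaCondLaw D t = (copulaCondLaw C t).map hcont.measurable.aemeasurable :=
    Subtype.ext h1
  rw [e]
  exact key.congr fun n => Subtype.ext (h2 n).symm

lemma ae_tendsto_copulaKernel_Iic (hC : IsContCondCopula C) (hconv : WeakCondTendsto Cn C) :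
    ∀ᵐ t : I, ∀ u, Tendsto (fun n => (copulaKernel (Cn n) t).real (Set.Iic u)) atTop
      (𝓝 ((copulaKernel C t).real (Set.Iic u))) := by
  filter_upwards [hC.ae_continuous_and_zero, hconv.2.2] with t ht hlim
  exact tendsto_measureReal_Iic_of_tendsto hlim ht.1 ht.2

lemma tendsto_marginTransform {t : I}
    (h : ∀ u, Tendsto (fun n => (copulaKernel (Cn n) t).real (Set.Iic u)) atTop
      (𝓝 ((copulaKernel C t).real (Set.Iic u)))) (u : Fin 2 → I) :
    Tendsto (fun n => marginTransform (copulaKernel (Cn n) t) u) atTop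
      (𝓝 (marginTransform (copulaKernel C t) u)) :=
  tendsto_pi_nhds.2 fun i => tendsto_marginCDF h i (u i)

lemma tendsto_partialCopula (hC : IsContCondCopula C) (hCn : ∀ n, IsContCondCopula (Cn n))
    (hconv : WeakCondTendsto Cn C) (s : Fin 2 → I) :
    Tendsto (fun n => partialCopula (Cn n) s) atTop (𝓝 (partialCopula C s)) := by
  refine tendsto_integral_of_dominated_convergence (fun _ => (1 : ℝ))
    (fun n => (hCn n).aestronglyMeasurable_condCopula s) (integrable_const _) (fun n => ?_) ?_
  · filter_upwards [(hCn n).condCopula_ae_eq s] with t ht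
    rw [ht, Real.norm_of_nonneg measureReal_nonneg]
    exact measureReal_le_one
  · filter_upwards [hC.ae_continuous_and_zero, ae_tendsto_copulaKernel_Iic hC hconv,
      ae_all_iff.2 fun n => (hCn n).ae_continuous_and_zero] with t ht hlim htn
    obtain ⟨u, rfl⟩ := surjective_marginTransform ht.1 ht.2 s
    rw [condCopula_marginTransform ht.1 ht.2]
    refine (hlim u).congr_dist ?_
    simp only [← condCopula_marginTransform (htn _).1 (htn _).2]
    exact tendsto_dist_copula_of_tendsto (fun n => isCopula_condCopula (htn n).1 (htn n).2)
      (tendsto_marginTransform hlim u)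

lemma WeakCondTendsto.partialVineCopula (hC : IsContCondCopula C)
    (hCn : ∀ n, IsContCondCopula (Cn n)) (hconv : WeakCondTendsto Cn C) :
    WeakCondTendsto (fun n => partialVineCopula (Cn n)) (partialVineCopula C) := by
  refine ⟨fun n => (hCn n).partialVineCopula_spec.1.1, hC.partialVineCopula_spec.1.1, ?_⟩
  filter_upwards [hC.partialVineCopula_spec.2, ae_tendsto_copulaKernel_Iic hC hconv,
    ae_all_iff.2 fun n => (hCn n).partialVineCopula_spec.2] with t ht hlim htn
  refine tendsto_probabilityMeasure_of_tendsto_Iic fun u => ?_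
  change Tendsto (fun n => (copulaKernel (_root_.partialVineCopula (Cn n)) t).real (Set.Iic u))
    atTop (𝓝 ((copulaKernel (_root_.partialVineCopula C) t).real (Set.Iic u)))
  simp only [ht, htn]
  refine (tendsto_partialCopula hC hCn hconv _).congr_dist ?_
  simp only [dist_comm (_root_.partialCopula _ (marginTransform (copulaKernel C t) u))]
  exact tendsto_dist_copula_of_tendsto (fun n => (hCn n).isCopula_partialCopula)
    (tendsto_marginTransform hlim u)

end Trivariate


theorem theorem6p3 (C : (Fin 3 → I) → ℝ) (Cn : ℕ → (Fin 3 → I) → ℝ)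
    (hC : IsContCondCopula C) (hCn : ∀ n, IsContCondCopula (Cn n))
    (hconv : WeakCondTendsto Cn C) :
    -- the (1,3) and (2,3) margins
    (WeakCondTendsto (fun n => margin13 (Cn n)) (margin13 C) ∧
      WeakCondTendsto (fun n => margin23 (Cn n)) (margin23 C)) ∧
    -- the partial copulas
    ((∀ n, IsCopula (partialCopula (Cn n))) ∧ IsCopula (partialCopula C) ∧
      Tendsto (fun n => copulaDInf (partialCopula (Cn n)) (partialCopula C)) atTop (𝓝 0)) ∧
    -- the partial vine copulas
    ((∀ n, IsContCondCopula (partialVineCopula (Cn n))) ∧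
      IsContCondCopula (partialVineCopula C) ∧
      WeakCondTendsto (fun n => partialVineCopula (Cn n)) (partialVineCopula C)) := by
  refine ⟨⟨?_, ?_⟩, ⟨fun n => (hCn n).isCopula_partialCopula, hC.isCopula_partialCopula, ?_⟩,
    fun n => (hCn n).partialVineCopula_spec.1, hC.partialVineCopula_spec.1,
    WeakCondTendsto.partialVineCopula hC hCn hconv⟩
  · exact hconv.of_margin 0 (margin13_eq_setIntegral hC.1)
      fun n => margin13_eq_setIntegral (hCn n).1
  · exact hconv.of_margin 1 (margin23_eq_setIntegral hC.1)
      fun n => margin23_eq_setIntegral (hCn n).1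
  · exact tendsto_copulaDInf_of_tendsto (fun n => (hCn n).isCopula_partialCopula)
      (tendsto_partialCopula hC hCn hconv)
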